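/- A convex domain is a compact convex subset of the Euclidean plane $\mathbb{E}^2$ with nonempty interior; it is $\mathbf{o}$-symmetric if $\mathbf{K}=-\mathbf{K}$, and smooth if at each of its boundary points it has exactly one supporting line. An $\mathbf{o}$-symmetric convex domain $\mathbf{K}$ is the unit ball of the norm $\|x\|_{\mathbf{K}}=\inf\{\lambda>0: x\in\lambda\mathbf{K}\}$ on $\mathbb{R}^2$; a nonzero vector $x$ is Birkhoff orthogonal to a nonzero vector $y$, written $x\dashv_{\mathbf{K}}y$, if $\|x\|_{\mathbf{K}}\le\|x+ty\|_{\mathbf{K}}$ for all $t\in\mathbb{R}$. For boundary points $x\neq\pm y$ of $\mathbf{K}$ let $[x,y]_{\mathbf{K}}$ denote the smaller closed arc of $\operatorname{bd}\mathbf{K}$ with end points $x$ and $y$, that is, the part of $\operatorname{bd}\mathbf{K}$ lying in the convex cone $\{ax+by: a,b\ge 0\}$. An $\mathbf{o}$-symmetric convex domain $\mathbf{D}$ is called a $B$-domain if there is a Borel measure $\mu$ on $\operatorname{bd}\mathbf{D}$ such that (i) $\mu(\operatorname{bd}\mathbf{D})=2\pi$; (ii) $\mu(X)=\mu(-X)$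 for every Borel set $X\subseteq\operatorname{bd}\mathbf{D}$; (iii) $\mu(\{x\})=0$ for every $x\in\operatorname{bd}\mathbf{D}$; and (iv) $\mu([x,y]_{\mathbf{D}})=\pi/2$ for all $x,y\in\operatorname{bd}\mathbf{D}$ with $x\dashv_{\mathbf{D}}y$. A packing of $n$ translates of a convex domain $\mathbf{K}$ (a family of $n$ translates with pairwise disjoint interiors) is totally separable if any two of its members can be separated by a line that is disjoint from the interior of every member. Its contact number is the number of unordered pairs of distinct members that touch, i.e. have a common point. Let $c_{\rm sep}(\mathbf{K},n,2)$ be the maximum contact number of a totally separable packing of $n$ translates of $\mathbf{K}$, and let $c_{\rm sep}(n,2)=c_{\rm sep}(\mathbf{B}^2,n,2)$, where $\mathbf{B}^2$ is the closed Euclidean unit disk. Theorem. If $\mathbf{D}$ is a smooth $B$-domain in $\mathbb{E}^2$ and $n\ge 2$ is an integer, then this maximum is attained for $\mathbf{D}$ and $$c_{\rm sep}(\mathbf{D},n,2)=c_{\rm sep}(n,2)=\lfloor 2n-2\sqrt{n}\rfloor .$$ -/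

import Mathlib

open scoped Pointwise

namespace SepPacking

/-- A convex body in Euclidean `d`-space: a compact convex set with nonempty interior
(a convex domain, when `d = 2`). -/
structure IsConvexBody {d : ℕ} (K : Set (EuclideanSpace ℝ (Fin d))) : Prop where
  isCompact : IsCompact K
  convex : Convex ℝ K
  interior_nonempty : (interior K).Nonempty

/-- The set `K` is `o`-symmetric: `K = -K`. -/
def IsOSymmetric {d : ℕ} (K : Set (EuclideanSpace ℝ (Fin d))) : Prop :=
  K = -K

/-- `H` is a hyperplane (a line, when `d = 2`) that supports `K` at the point `p`. -/
def IsSupportingHyperplane {d : ℕ} (H K : Set (EuclideanSpace ℝ (Fin d)))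
    (p : EuclideanSpace ℝ (Fin d)) : Prop :=
  ∃ u : EuclideanSpace ℝ (Fin d), u ≠ 0 ∧
    H = {x | inner ℝ u x = inner ℝ u p} ∧ ∀ x ∈ K, inner ℝ u x ≤ inner ℝ u p

/-- `K` is smooth: at every boundary point it is supported by a unique hyperplane. -/
def IsSmooth {d : ℕ} (K : Set (EuclideanSpace ℝ (Fin d))) : Prop :=
  ∀ p ∈ frontier K, ∃! H : Set (EuclideanSpace ℝ (Fin d)), IsSupportingHyperplane H K p

/-- The translates `c i + K` form a packing: no two of them overlap. -/
def IsPacking {d n : ℕ} (K : Set (EuclideanSpace ℝ (Fin d)))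
    (c : Fin n → EuclideanSpace ℝ (Fin d)) : Prop :=
  ∀ i j, i ≠ j → Disjoint (interior (c i +ᵥ K)) (interior (c j +ᵥ K))

/-- The translates `c i + K` form a totally separable packing: any two of them are separated by
a hyperplane `{x | ⟪u, x⟫ = a}` that is disjoint from the interior of every one of them. -/
def IsTotallySeparablePacking {d n : ℕ} (K : Set (EuclideanSpace ℝ (Fin d)))
    (c : Fin n → EuclideanSpace ℝ (Fin d)) : Prop :=
  IsPacking K c ∧
    ∀ i j, i ≠ j → ∃ (u : EuclideanSpace ℝ (Fin d)) (a : ℝ), u ≠ 0 ∧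
      (∀ x ∈ c i +ᵥ K, inner ℝ u x ≤ a) ∧
      (∀ x ∈ c j +ᵥ K, a ≤ inner ℝ u x) ∧
      ∀ k, Disjoint {x | inner ℝ u x = a} (interior (c k +ᵥ K))

/-- The contact graph of the family `c i + K`: two (distinct) members are adjacent if and only if
they touch. (Members of a packing do not overlap, so touching means having a common point.) -/
def contactGraph {d n : ℕ} (K : Set (EuclideanSpace ℝ (Fin d)))
    (c : Fin n → EuclideanSpace ℝ (Fin d)) : SimpleGraph (Fin n) where
  Adj i j := i ≠ j ∧ ((c i +ᵥ K) ∩ (c j +ᵥ K)).Nonempty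
  symm := ⟨fun _ _ h => ⟨h.1.symm, by rw [Set.inter_comm]; exact h.2⟩⟩
  loopless := ⟨fun _ h => h.1 rfl⟩

/-- The contact number of the family `c i + K`: the number of edges of its contact graph. -/
noncomputable def contactNumber {d n : ℕ} (K : Set (EuclideanSpace ℝ (Fin d)))
    (c : Fin n → EuclideanSpace ℝ (Fin d)) : ℕ :=
  (contactGraph K c).edgeSet.ncard

/-- The contact numbers of all totally separable packings of `n` translates of `K`. -/
def sepContactNumbers {d : ℕ} (K : Set (EuclideanSpace ℝ (Fin d))) (n : ℕ) : Set ℕ :=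
  {m | ∃ c : Fin n → EuclideanSpace ℝ (Fin d),
    IsTotallySeparablePacking K c ∧ contactNumber K c = m}

/-- The maximum separable contact number `c_sep(K, n, d)`. -/
noncomputable def cSep {d : ℕ} (K : Set (EuclideanSpace ℝ (Fin d))) (n : ℕ) : ℕ :=
  sSup (sepContactNumbers K n)

/-- `x` is Birkhoff orthogonal to `y` in the norm with unit ball `K`
(the norm is the gauge `inf {r > 0 | x ∈ r K}`). -/
def BirkhoffOrthogonal {d : ℕ} (K : Set (EuclideanSpace ℝ (Fin d)))
    (x y : EuclideanSpace ℝ (Fin d)) : Prop :=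
  x ≠ 0 ∧ y ≠ 0 ∧ ∀ t : ℝ, gauge K x ≤ gauge K (x + t • y)

/-- For boundary points `x ≠ ±y` of an `o`-symmetric convex domain `K`, the smaller closed arc of
the boundary with end points `x` and `y`: the part of the boundary in the angle with apex `o`
spanned by `x` and `y`. (Birkhoff orthogonal vectors are linearly independent, so the tie `y = -x`
plays no role for them.) -/
def arc (K : Set (EuclideanSpace ℝ (Fin 2))) (x y : EuclideanSpace ℝ (Fin 2)) :
    Set (EuclideanSpace ℝ (Fin 2)) :=
  {z | z ∈ frontier K ∧ ∃ a b : ℝ, 0 ≤ a ∧ 0 ≤ b ∧ z = a • x + b • y}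

/-- An angle measure in the normed plane with unit ball `K`: a Borel measure on the boundary of
`K` (as a measure on the plane, it vanishes off the boundary) of total mass `2π`, symmetric
and without atoms. An angle with an arbitrary apex is measured by translating the apex to `o`. -/
structure IsAngleMeasure (K : Set (EuclideanSpace ℝ (Fin 2)))
    (μ : MeasureTheory.Measure (EuclideanSpace ℝ (Fin 2))) : Prop where
  off_boundary : μ (frontier K)ᶜ = 0
  total : μ (frontier K) = ENNReal.ofReal (2 * Real.pi)
  symmetric : ∀ X : Set (EuclideanSpace ℝ (Fin 2)),
    MeasurableSet X → X ⊆ frontier K → μ X = μ (-X)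
  no_atoms : ∀ x ∈ frontier K, μ {x} = 0

/-- A `B`-measure: an angle measure that gives mass `π/2` to the arc between any two boundary
points the first of which is Birkhoff orthogonal to the second. -/
structure IsBMeasure (K : Set (EuclideanSpace ℝ (Fin 2)))
    (μ : MeasureTheory.Measure (EuclideanSpace ℝ (Fin 2))) : Prop extends IsAngleMeasure K μ where
  arc_eq : ∀ x ∈ frontier K, ∀ y ∈ frontier K, BirkhoffOrthogonal K x y →
    μ (arc K x y) = ENNReal.ofReal (Real.pi / 2)

/-- A `B`-domain: an `o`-symmetric convex domain whose normed plane carries a `B`-measure. -/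
structure IsBDomain (D : Set (EuclideanSpace ℝ (Fin 2))) : Prop where
  isConvexBody : IsConvexBody D
  isOSymmetric : IsOSymmetric D
  exists_bMeasure : ∃ μ : MeasureTheory.Measure (EuclideanSpace ℝ (Fin 2)), IsBMeasure D μ

end SepPacking

/-! The argument rests on smoothness and central symmetry. Fix an Auerbach basis of the plane normed
by `D` and cut the nonzero vectors into four half-open quadrants. In a totally separable packing
every translate has at most one neighbour in each quadrant (`IsAuerbach.eq_of_adj`). The line
separating two touching translates must support both at a contact point, and smoothness rules out a
further neighbour beyond it (`exists_form_of_adj`). Two neighbours of the same translate in one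
quadrant would then contradict the geometry of the Auerbach basis
(`IsAuerbach.false_of_mem_quadrant`).

Orient each contact so that its displacement lies in the first or the second quadrant. The contacts
of each type form disjoint directed paths, say `r` and `s` of them, counting isolated vertices as
paths, so there are at most `(n - r) + (n - s)` contacts. A path of one type and a path of the other
share at most one vertex, because displacements along them lie in opposite pairs of quadrants. Hence
`n ≤ r s`, and the arithmetic-geometric mean inequality gives the bound `2n - 2√n`.

Conversely, the lattice generated by twice the Auerbach basis behaves like the square lattice, and
filling rows of length `⌈√n⌉` attains the integer part of the bound. The disk is also smooth and
symmetric, so its value is the same. -/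

namespace SepPacking

/-! ### Counting edges by two families of directed paths -/

open Relation

/-- If every vertex has at most one successor and at most one predecessor with respect to each of
two relations `A` and `B` that cover the edges of `G`, and if their displacements lie in two convex
cones with trivial intersection, then `G` has at most `2n - 2√n` edges. -/
theorem ncard_edgeSet_le_of_two_chain_relations {V E : Type*} [Fintype V] [AddCommGroup E]
    (G : SimpleGraph V) (c : V → E) (A B : E → Prop) (hA0 : ¬ A 0) (hB0 : ¬ B 0)
    (hAadd : ∀ x y, A x → A y → A (x + y)) (hBadd : ∀ x y, B x → B y → B (x + y))
    (hAB : ∀ x, A x → ¬ B x) (hAB' : ∀ x, A x → ¬ B (-x))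
    (hcover : ∀ i j, G.Adj i j →
      A (c j - c i) ∨ B (c j - c i) ∨ A (c i - c j) ∨ B (c i - c j))
    (hAout : ∀ i j k, G.Adj i j → G.Adj i k → A (c j - c i) → A (c k - c i) → j = k)
    (hBout : ∀ i j k, G.Adj i j → G.Adj i k → B (c j - c i) → B (c k - c i) → j = k)
    (hAin : ∀ i j k, G.Adj i j → G.Adj i k → A (c i - c j) → A (c i - c k) → j = k)
    (hBin : ∀ i j k, G.Adj i j → G.Adj i k → B (c i - c j) → B (c i - c k) → j = k) :
    (G.edgeSet.ncard : ℝ) ≤ 2 * Fintype.card V - 2 * Real.sqrt (Fintype.card V) := by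
  classical
  -- `ρ v` is the last vertex of the directed path through `v`. Displacements add up within the cone
  -- and never vanish, so there are no cycles. Uniqueness of predecessors makes any two vertices
  -- with the same end comparable.
  have chain : ∀ (P : E → Prop), ¬ P 0 → (∀ x y, P x → P y → P (x + y)) →
      (∀ i j k, G.Adj i j → G.Adj i k → P (c i - c j) → P (c i - c k) → j = k) →
      ∃ ρ : V → V, (∀ v w, ¬ (G.Adj (ρ v) w ∧ P (c w - c (ρ v)))) ∧
        ∀ p q, ρ p = ρ q → p = q ∨ P (c q - c p) ∨ P (c p - c q) := by
    intro P hP0 hPadd hPin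
    let r : V → V → Prop := fun i j => G.Adj i j ∧ P (c j - c i)
    have htrans : ∀ i j, TransGen r i j → P (c j - c i) := by
      intro i j h
      induction h with
      | single h => exact h.2
      | tail _ h ih => have := hPadd _ _ h.2 ih; simpa using this
    have hrefl : ∀ i j, ReflTransGen r i j → i = j ∨ P (c j - c i) := by
      intro i j h
      rcases reflTransGen_iff_eq_or_transGen.1 h with h | h
      · exact Or.inl h.symm
      · exact Or.inr (htrans _ _ h)
    have hwf : WellFounded (fun i j => TransGen r j i) := by
      have : Std.Irrefl (fun i j => TransGen r j i) :=
        ⟨fun i h => hP0 (by simpa using htrans _ _ h)⟩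
      have : IsTrans V (fun i j => TransGen r j i) := ⟨fun _ _ _ h h' => h'.trans h⟩
      exact Finite.wellFounded_of_trans_of_irrefl _
    have hroot : ∀ v, ∃ t, ReflTransGen r v t ∧ ∀ w, ¬ r t w := by
      intro v
      induction v using hwf.induction with
      | _ v ih =>
        by_cases h : ∃ w, r v w
        · obtain ⟨w, hw⟩ := h
          obtain ⟨t, ht, ht'⟩ := ih w (.single hw)
          exact ⟨t, .head hw ht, ht'⟩
        · exact ⟨v, .refl, fun w hw => h ⟨w, hw⟩⟩
    choose ρ hρ hρ' using hroot
    refine ⟨ρ, fun v w h => hρ' v w h, fun p q hpq => ?_⟩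
    have hU : Relator.RightUnique (Function.swap r) := fun a b d h h' =>
      hPin a b d h.1.symm h'.1.symm h.2 h'.2
    have h1 : ReflTransGen (Function.swap r) (ρ p) p := reflTransGen_swap.2 (hρ p)
    have h2 : ReflTransGen (Function.swap r) (ρ p) q := by
      rw [hpq]; exact reflTransGen_swap.2 (hρ q)
    rcases ReflTransGen.total_of_right_unique hU h1 h2 with h | h
    · rcases hrefl _ _ (reflTransGen_swap.1 h) with h | h
      · exact Or.inl h.symm
      · exact Or.inr (Or.inr h)
    · rcases hrefl _ _ (reflTransGen_swap.1 h) with h | h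
      · exact Or.inl h
      · exact Or.inr (Or.inl h)
  obtain ⟨α, hα, hα'⟩ := chain A hA0 hAadd hAin
  obtain ⟨β, hβ, hβ'⟩ := chain B hB0 hBadd hBin
  let SA : Finset V := {v | ∃ w, G.Adj v w ∧ A (c w - c v)}
  let SB : Finset V := {v | ∃ w, G.Adj v w ∧ B (c w - c v)}
  -- A vertex is determined by the ends of its two paths: two vertices sharing both would have a
  -- displacement in `A` or `-A` and also in `B` or `-B`.
  have hcard : Fintype.card V ≤ SAᶜ.card * SBᶜ.card := by
    rw [← Finset.card_product, ← Finset.card_univ]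
    refine Finset.card_le_card_of_injOn (fun v => (α v, β v)) ?_ ?_
    · intro v _
      simp only [Finset.coe_product, Set.mem_prod, Finset.mem_coe, Finset.mem_compl, SA, SB,
        Finset.mem_filter, Finset.mem_univ, true_and]
      exact ⟨fun ⟨w, hw⟩ => hα v w hw, fun ⟨w, hw⟩ => hβ v w hw⟩
    · intro p _ q _ hpq
      simp only [Prod.mk.injEq] at hpq
      rcases hα' p q hpq.1 with h | h | h
      · exact h
      · rcases hβ' p q hpq.2 with h' | h' | h'
        · exact h'
        · exact (hAB _ h h').elim
        · exact (hAB' _ h (by simpa using h')).elim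
      · rcases hβ' p q hpq.2 with h' | h' | h'
        · exact h'
        · exact (hAB' _ h (by simpa using h')).elim
        · exact (hAB _ h h').elim
  have hedge : G.edgeSet.ncard ≤ SA.card + SB.card := by
    -- Each edge is charged to its tail; the default value `v` is never used on `SA`.
    let a : V → V := fun v => if h : ∃ w, G.Adj v w ∧ A (c w - c v) then h.choose else v
    let b : V → V := fun v => if h : ∃ w, G.Adj v w ∧ B (c w - c v) then h.choose else v
    have ha : ∀ v w, G.Adj v w → A (c w - c v) → v ∈ SA ∧ a v = w := by
      intro v w h h'
      have hex : ∃ w, G.Adj v w ∧ A (c w - c v) := ⟨w, h, h'⟩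
      refine ⟨by simpa [SA] using hex, ?_⟩
      simp only [a, dif_pos hex]
      exact hAout v _ _ hex.choose_spec.1 h hex.choose_spec.2 h'
    have hb : ∀ v w, G.Adj v w → B (c w - c v) → v ∈ SB ∧ b v = w := by
      intro v w h h'
      have hex : ∃ w, G.Adj v w ∧ B (c w - c v) := ⟨w, h, h'⟩
      refine ⟨by simpa [SB] using hex, ?_⟩
      simp only [b, dif_pos hex]
      exact hBout v _ _ hex.choose_spec.1 h hex.choose_spec.2 h'
    have hsub : G.edgeSet ⊆
        ((SA.image fun v => s(v, a v)) ∪ (SB.image fun v => s(v, b v)) : Finset (Sym2 V)) := by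
      intro e
      induction e using Sym2.ind with
      | _ i j =>
        intro h
        have h : G.Adj i j := h
        simp only [Finset.coe_union, Finset.coe_image, Set.mem_union, Set.mem_image,
          Finset.mem_coe]
        rcases hcover i j h with h' | h' | h' | h'
        · obtain ⟨h1, h2⟩ := ha _ _ h h'
          exact Or.inl ⟨i, h1, by rw [h2]⟩
        · obtain ⟨h1, h2⟩ := hb _ _ h h'
          exact Or.inr ⟨i, h1, by rw [h2]⟩
        · obtain ⟨h1, h2⟩ := ha _ _ h.symm h'
          exact Or.inl ⟨j, h1, by rw [h2, Sym2.eq_swap]⟩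
        · obtain ⟨h1, h2⟩ := hb _ _ h.symm h'
          exact Or.inr ⟨j, h1, by rw [h2, Sym2.eq_swap]⟩
    calc G.edgeSet.ncard ≤ _ := Set.ncard_le_ncard hsub (Finset.finite_toSet _)
      _ = _ := Set.ncard_coe_finset _
      _ ≤ _ := Finset.card_union_le _ _
      _ ≤ _ := add_le_add Finset.card_image_le Finset.card_image_le
  have hA : (SA.card : ℝ) + SAᶜ.card = Fintype.card V := by
    exact_mod_cast Finset.card_add_card_compl SA
  have hB : (SB.card : ℝ) + SBᶜ.card = Fintype.card V := by
    exact_mod_cast Finset.card_add_card_compl SB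
  have hcard' : (Fintype.card V : ℝ) ≤ SAᶜ.card * SBᶜ.card := by exact_mod_cast hcard
  have hedge' : (G.edgeSet.ncard : ℝ) ≤ SA.card + SB.card := by exact_mod_cast hedge
  have hsqrt : 2 * Real.sqrt (Fintype.card V) ≤ (SAᶜ.card : ℝ) + SBᶜ.card := by
    have : Real.sqrt (Fintype.card V) ≤ ((SAᶜ.card : ℝ) + SBᶜ.card) / 2 := by
      apply Real.sqrt_le_iff.2 ⟨by positivity, ?_⟩
      nlinarith [sq_nonneg ((SAᶜ.card : ℝ) - SBᶜ.card)]
    linarith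
  linarith

/-! ### Symmetric convex bodies, separating lines and smoothness -/

variable {D : Set (EuclideanSpace ℝ (Fin 2))}

theorem IsOSymmetric.neg_mem {d : ℕ} {K : Set (EuclideanSpace ℝ (Fin d))} (h : IsOSymmetric K)
    {x : EuclideanSpace ℝ (Fin d)} (hx : x ∈ K) : -x ∈ K := by
  rw [h]; simpa using hx

theorem IsConvexBody.zero_mem_interior {d : ℕ} {K : Set (EuclideanSpace ℝ (Fin d))}
    (hK : IsConvexBody K) (hs : IsOSymmetric K) : (0 : EuclideanSpace ℝ (Fin d)) ∈ interior K := by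
  obtain ⟨x, hx⟩ := hK.interior_nonempty
  have hx' : -x ∈ K := hs.neg_mem (interior_subset hx)
  have := hK.convex.combo_interior_self_mem_interior hx hx'
    (a := 1 / 2) (b := 1 / 2) (by norm_num) (by norm_num) (by norm_num)
  simpa using this

theorem IsConvexBody.smul_mem_interior {d : ℕ} {K : Set (EuclideanSpace ℝ (Fin d))}
    (hK : IsConvexBody K) (hs : IsOSymmetric K) {x : EuclideanSpace ℝ (Fin d)} (hx : x ∈ K) {t : ℝ}
    (ht : |t| < 1) : t • x ∈ interior K := by
  have key : ∀ y ∈ K, ∀ s : ℝ, 0 ≤ s → s < 1 → s • y ∈ interior K := by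
    intro y hy s h0 h1
    have := hK.convex.combo_interior_self_mem_interior (hK.zero_mem_interior hs) hy
      (a := 1 - s) (b := s) (by linarith) h0 (by ring)
    simpa using this
  rcases le_total 0 t with h | h
  · exact key x hx t h (by rwa [abs_of_nonneg h] at ht)
  · have := key (-x) (hs.neg_mem hx) (-t) (by linarith) (by rwa [abs_of_nonpos h] at ht)
    simpa using this

/-- From an interior point one can move a little in every direction. -/
theorem eventually_add_smul_mem {d : ℕ} {K : Set (EuclideanSpace ℝ (Fin d))}
    {x : EuclideanSpace ℝ (Fin d)} (hx : x ∈ interior K) (u : EuclideanSpace ℝ (Fin d)) :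
    ∀ᶠ t : ℝ in nhdsWithin 0 (Set.Ioi 0), x + t • u ∈ K := by
  have hc : Filter.Tendsto (fun t : ℝ => x + t • u) (nhds 0) (nhds x) := by
    have : Continuous (fun t : ℝ => x + t • u) := by fun_prop
    simpa using this.tendsto 0
  exact (hc.eventually (mem_interior_iff_mem_nhds.1 hx)).filter_mono nhdsWithin_le_nhds

/-- A nonzero linear form is smaller than its upper bounds at interior points. -/
theorem inner_lt_of_mem_interior {d : ℕ} {K : Set (EuclideanSpace ℝ (Fin d))}
    {u x : EuclideanSpace ℝ (Fin d)} {s : ℝ} (hu : u ≠ 0) (hle : ∀ z ∈ K, inner ℝ u z ≤ s)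
    (hx : x ∈ interior K) : inner ℝ u x < s := by
  obtain ⟨t, ht, ht0⟩ := ((eventually_add_smul_mem hx u).and self_mem_nhdsWithin).exists
  have h1 := hle _ ht
  rw [inner_add_right, real_inner_smul_right, real_inner_self_eq_norm_sq] at h1
  have : 0 < t * ‖u‖ ^ 2 := mul_pos ht0 (by positivity)
  linarith

/-- A nonzero linear form attains a positive maximum on an `o`-symmetric convex body. -/
theorem IsConvexBody.exists_max_inner {d : ℕ} {K : Set (EuclideanSpace ℝ (Fin d))}
    (hK : IsConvexBody K) (hs : IsOSymmetric K) {u : EuclideanSpace ℝ (Fin d)} (hu : u ≠ 0) :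
    ∃ p ∈ K, 0 < inner ℝ u p ∧ ∀ x ∈ K, inner ℝ u x ≤ inner ℝ u p := by
  have h0 := hK.zero_mem_interior hs
  obtain ⟨p, hp, hmax⟩ := hK.isCompact.exists_isMaxOn ⟨0, interior_subset h0⟩
    (f := fun x => inner ℝ u x) (by fun_prop)
  refine ⟨p, hp, ?_, fun x hx => hmax hx⟩
  simpa using inner_lt_of_mem_interior hu (fun z hz => hmax hz) h0

/-- A separating line of a totally separable packing, with its normal scaled so that the body has
support number at most one. -/
theorem IsTotallySeparablePacking.exists_unit_form {d n : ℕ} {K : Set (EuclideanSpace ℝ (Fin d))}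
    (hK : IsConvexBody K) (hs : IsOSymmetric K) {c : Fin n → EuclideanSpace ℝ (Fin d)}
    (hc : IsTotallySeparablePacking K c) {i j : Fin n} (hij : i ≠ j) :
    ∃ (u : EuclideanSpace ℝ (Fin d)) (b : ℝ), (∀ x ∈ K, inner ℝ u x ≤ 1) ∧
      inner ℝ u (c i) + 1 ≤ b ∧ b ≤ inner ℝ u (c j) - 1 ∧
      ∀ k, inner ℝ u (c k) + 1 ≤ b ∨ b ≤ inner ℝ u (c k) - 1 := by
  obtain ⟨u, a, hu, hi, hj, hk⟩ := hc.2 i j hij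
  obtain ⟨p, hp, hpos, hmax⟩ := hK.exists_max_inner hs hu
  set H : ℝ := inner ℝ u p with hH
  have hi' : inner ℝ u (c i) + H ≤ a := by
    have := hi (c i + p) (Set.mem_vadd_set.2 ⟨p, hp, rfl⟩)
    rwa [inner_add_right] at this
  have hj' : a ≤ inner ℝ u (c j) - H := by
    have := hj (c j + -p) (Set.mem_vadd_set.2 ⟨-p, hs.neg_mem hp, rfl⟩)
    rwa [inner_add_right, inner_neg_right, ← sub_eq_add_neg] at this
  have hk' : ∀ k, inner ℝ u (c k) + H ≤ a ∨ a ≤ inner ℝ u (c k) - H := by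
    intro k
    -- Otherwise the line passes at distance less than `H` from the centre, as measured by `u`, and
    -- meets the interior at a point `c k + t • p` with `|t| < 1`.
    by_contra! h
    refine Set.disjoint_left.1 (hk k) (?_ : c k + ((a - inner ℝ u (c k)) / H) • p ∈ _) ?_
    · simp only [Set.mem_ofPred_eq, inner_add_right, real_inner_smul_right, ← hH]
      field_simp
      ring
    · rw [interior_vadd]
      refine Set.mem_vadd_set.2 ⟨_, hK.smul_mem_interior hs hp ?_, rfl⟩
      rw [abs_lt, lt_div_iff₀ hpos, div_lt_iff₀ hpos]
      constructor <;> linarith [h.1, h.2]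
  have key : ∀ s : ℝ, H⁻¹ * s = s / H := fun s => by rw [inv_mul_eq_div]
  refine ⟨H⁻¹ • u, a / H, fun x hx => ?_, ?_, ?_, fun k => ?_⟩
  · rw [real_inner_smul_left, key, div_le_one hpos]; exact hmax x hx
  · rw [real_inner_smul_left, key, ← div_self hpos.ne', ← add_div]; gcongr
  · rw [real_inner_smul_left, key, ← div_self hpos.ne', ← sub_div]; gcongr
  · rw [real_inner_smul_left, key, ← div_self hpos.ne', ← add_div, ← sub_div]
    rcases hk' k with h | h
    · left; gcongr
    · right; gcongr

/-- Touching translates differ by twice a vector of the body. -/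
theorem contactGraph_adj_exists {d n : ℕ} {K : Set (EuclideanSpace ℝ (Fin d))}
    (hK : IsConvexBody K) (hs : IsOSymmetric K) {c : Fin n → EuclideanSpace ℝ (Fin d)}
    {i j : Fin n} (h : (contactGraph K c).Adj i j) : ∃ x ∈ K, c j = c i + (2 : ℝ) • x := by
  obtain ⟨-, z, hz, hz'⟩ := h
  obtain ⟨a, ha, rfl⟩ := Set.mem_vadd_set.1 hz
  obtain ⟨b, hb, hab⟩ := Set.mem_vadd_set.1 hz'
  simp only [vadd_eq_add] at hab
  refine ⟨(1 / 2 : ℝ) • a + (1 / 2 : ℝ) • (-b),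
    hK.convex ha (hs.neg_mem hb) (by norm_num) (by norm_num) (by norm_num), ?_⟩
  rw [smul_add, smul_smul, smul_smul]
  norm_num
  rw [← add_assoc, ← hab]
  abel

/-- Two linear forms supporting a smooth body at the same point have the same level line there. -/
theorem IsSmooth.inner_eq_one {d : ℕ} {K : Set (EuclideanSpace ℝ (Fin d))} (hsm : IsSmooth K)
    {u v x y : EuclideanSpace ℝ (Fin d)} (hx : x ∈ K) (hu : ∀ z ∈ K, inner ℝ u z ≤ 1)
    (hv : ∀ z ∈ K, inner ℝ v z ≤ 1) (hux : inner ℝ u x = 1) (hvx : inner ℝ v x = 1)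
    (hy : inner ℝ u y = 1) : inner ℝ v y = 1 := by
  have hu0 : u ≠ 0 := by rintro rfl; simp at hux
  have hv0 : v ≠ 0 := by rintro rfl; simp at hvx
  have hfr : x ∈ frontier K := by
    exact ⟨subset_closure hx, fun hint => (inner_lt_of_mem_interior hu0 hu hint).ne hux⟩
  have := (hsm x hfr).unique (y₁ := {z | inner ℝ u z = inner ℝ u x})
    (y₂ := {z | inner ℝ v z = inner ℝ v x}) ⟨u, hu0, rfl, fun z hz => by rw [hux]; exact hu z hz⟩
    ⟨v, hv0, rfl, fun z hz => by rw [hvx]; exact hv z hz⟩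
  have hmem : y ∈ {z | inner ℝ u z = inner ℝ u x} := by rw [Set.mem_ofPred_eq, hux, hy]
  rw [this, Set.mem_ofPred_eq, hvx] at hmem
  exact hmem

/-- In a totally separable packing of a smooth body, the line through the contact point of two
touching translates has every further neighbour of the first one on the side of the first one. -/
theorem exists_form_of_adj {d n : ℕ} {K : Set (EuclideanSpace ℝ (Fin d))}
    (hK : IsConvexBody K) (hs : IsOSymmetric K) (hsm : IsSmooth K)
    {c : Fin n → EuclideanSpace ℝ (Fin d)} (hc : IsTotallySeparablePacking K c) {i j k : Fin n}
    (hij : i ≠ j) (hjk : j ≠ k) {x y : EuclideanSpace ℝ (Fin d)} (hx : x ∈ K) (hy : y ∈ K)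
    (hjx : c j = c i + (2 : ℝ) • x) (hky : c k = c i + (2 : ℝ) • y) :
    ∃ u : EuclideanSpace ℝ (Fin d), (∀ z ∈ K, inner ℝ u z ≤ 1) ∧ inner ℝ u x = 1 ∧
      inner ℝ u y ≤ 0 := by
  obtain ⟨u, b, hu, hi, hj, hk⟩ := hc.exists_unit_form hK hs hij
  obtain ⟨g, a, hg, gj, gk, gi⟩ := hc.exists_unit_form hK hs hjk
  have hux := hu x hx
  have huy := hu y hy
  have hk := hk k
  have gi := gi i
  rw [hjx, inner_add_right, real_inner_smul_right] at hj gj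
  rw [hky, inner_add_right, real_inner_smul_right] at hk gk
  have hux1 : inner ℝ u x = 1 := by linarith
  refine ⟨u, hu, hux1, ?_⟩
  -- If translate `k` lies beyond the line, then `u` supports `K` at both `x` and `y`. A line
  -- separating `j` from `k` has `g y - g x ≥ 1`. Whichever side of it `i` is on, `g` supports at
  -- `y` or `-g` supports at `x`, and smoothness forces `g x = g y`.
  rcases hk with hk | hk
  · linarith
  · exfalso
    have huy1 : inner ℝ u y = 1 := by linarith
    rcases gi with gi | gi
    · have hgy : inner ℝ g y = 1 := by linarith [hg y hy]
      have := hsm.inner_eq_one hy hu hg huy1 hgy hux1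
      linarith
    · have hng : ∀ z ∈ K, inner ℝ (-g) z ≤ 1 := fun z hz => by
        have := hg _ (hs.neg_mem hz)
        rwa [inner_neg_right, ← inner_neg_left] at this
      have hgx : inner ℝ (-g) x = 1 := by
        have := hng x hx
        rw [inner_neg_left] at this ⊢
        linarith
      have := hsm.inner_eq_one hx hu hng hux1 hgx huy1
      rw [inner_neg_left] at this hgx
      linarith

/-! ### Auerbach bases, quadrants and the upper bound -/

/-- An Auerbach basis `e₁, e₂` of the plane normed by `D`, with its dual basis `p₁, p₂`. -/
structure IsAuerbach (D : Set (EuclideanSpace ℝ (Fin 2)))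
    (e₁ e₂ p₁ p₂ : EuclideanSpace ℝ (Fin 2)) : Prop where
  mem₁ : e₁ ∈ D
  mem₂ : e₂ ∈ D
  le₁ : ∀ x ∈ D, inner ℝ p₁ x ≤ 1
  le₂ : ∀ x ∈ D, inner ℝ p₂ x ≤ 1
  dual₁₁ : inner ℝ p₁ e₁ = 1
  dual₁₂ : inner ℝ p₁ e₂ = 0
  dual₂₁ : inner ℝ p₂ e₁ = 0
  dual₂₂ : inner ℝ p₂ e₂ = 1
  expand : ∀ x, x = (inner ℝ p₁ x : ℝ) • e₁ + (inner ℝ p₂ x : ℝ) • e₂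

/-- A quarter turn of the basis carries statements about the first quadrant to the other three. -/
theorem IsAuerbach.rotate (hs : IsOSymmetric D) {e₁ e₂ p₁ p₂ : EuclideanSpace ℝ (Fin 2)}
    (h : IsAuerbach D e₁ e₂ p₁ p₂) : IsAuerbach D e₂ (-e₁) p₂ (-p₁) where
  mem₁ := h.mem₂
  mem₂ := hs.neg_mem h.mem₁
  le₁ := h.le₂
  le₂ x hx := by
    have := h.le₁ _ (hs.neg_mem hx)
    rwa [inner_neg_right, ← inner_neg_left] at this
  dual₁₁ := h.dual₂₂
  dual₁₂ := by simp [h.dual₂₁]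
  dual₂₁ := by simp [h.dual₁₂]
  dual₂₂ := by simp [h.dual₁₁]
  expand x := by
    have := h.expand x
    simp only [inner_neg_left, neg_smul, smul_neg, neg_neg]
    rwa [add_comm]

/-- A pair `a, b` in `D` of maximal determinant `Δ` works: the dual forms are `det(·, b) / Δ` and
`det(a, ·) / Δ`, bounded by one on `D` by maximality. -/
theorem exists_isAuerbach (hD : IsConvexBody D) (hs : IsOSymmetric D) :
    ∃ e₁ e₂ p₁ p₂, IsAuerbach D e₁ e₂ p₁ p₂ := by
  have h0 := hD.zero_mem_interior hs
  let F : EuclideanSpace ℝ (Fin 2) × EuclideanSpace ℝ (Fin 2) → ℝ :=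
    fun z => z.1 0 * z.2 1 - z.1 1 * z.2 0
  obtain ⟨⟨a, b⟩, ⟨ha, hb⟩, hmax⟩ := (hD.isCompact.prod hD.isCompact).exists_isMaxOn
    ⟨(0, 0), interior_subset h0, interior_subset h0⟩ (f := F) (by fun_prop)
  simp only at ha hb
  have hmax' : ∀ x ∈ D, ∀ y ∈ D, x 0 * y 1 - x 1 * y 0 ≤ a 0 * b 1 - a 1 * b 0 :=
    fun x hx y hy => hmax (a := (x, y)) ⟨hx, hy⟩
  obtain ⟨Δ, hΔ⟩ : ∃ Δ, Δ = a 0 * b 1 - a 1 * b 0 := ⟨_, rfl⟩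
  rw [← hΔ] at hmax'
  have hpos : 0 < Δ := by
    have hev : ∀ v : EuclideanSpace ℝ (Fin 2),
        ∀ᶠ t : ℝ in nhdsWithin 0 (Set.Ioi 0), t • v ∈ D := fun v => by
      simpa using eventually_add_smul_mem h0 v
    obtain ⟨t, ⟨h1, h2⟩, ht⟩ :=
      (((hev !₂[1, 0]).and (hev !₂[0, 1])).and self_mem_nhdsWithin).exists
    have := hmax' _ h1 _ h2
    simp at this
    have ht : 0 < t := ht
    nlinarith
  have hin : ∀ (s t : ℝ) (x : EuclideanSpace ℝ (Fin 2)),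
      inner ℝ !₂[s, t] x = s * x 0 + t * x 1 := by
    intro s t x
    simp [PiLp.inner_apply, Fin.sum_univ_two]
    ring
  refine ⟨a, b, !₂[b 1 / Δ, - b 0 / Δ], !₂[- a 1 / Δ, a 0 / Δ],
    ha, hb, fun x hx => ?_, fun x hx => ?_, ?_, ?_, ?_, ?_, fun x => ?_⟩
  · have := hmax' x hx b hb
    rw [hin, div_mul_eq_mul_div, div_mul_eq_mul_div, ← add_div, div_le_one hpos]; linarith
  · have := hmax' a ha x hx
    rw [hin, div_mul_eq_mul_div, div_mul_eq_mul_div, ← add_div, div_le_one hpos]; linarith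
  · rw [hin]; field_simp; linarith
  · rw [hin]; field_simp; ring
  · rw [hin]; field_simp; ring
  · rw [hin]; field_simp; linarith
  · ext l
    simp only [hin, PiLp.add_apply, PiLp.smul_apply, smul_eq_mul]
    fin_cases l
    · simp; field_simp; rw [hΔ]; ring
    · simp; field_simp; rw [hΔ]; ring

/-- Two boundary points in the same half-open quadrant of an Auerbach basis do not admit
supporting forms that are nonpositive at the respective other point. -/
theorem IsAuerbach.false_of_mem_quadrant (hsm : IsSmooth D)
    {e₁ e₂ p₁ p₂ : EuclideanSpace ℝ (Fin 2)} (h : IsAuerbach D e₁ e₂ p₁ p₂)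
    {x y u v : EuclideanSpace ℝ (Fin 2)} (hx : x ∈ D) (hy : y ∈ D)
    (hx₁ : 0 < inner ℝ p₁ x) (hx₂ : 0 ≤ inner ℝ p₂ x)
    (hy₁ : 0 < inner ℝ p₁ y) (hy₂ : 0 ≤ inner ℝ p₂ y)
    (hu : ∀ z ∈ D, inner ℝ u z ≤ 1) (hux : inner ℝ u x = 1) (huy : inner ℝ u y ≤ 0)
    (hv : ∀ z ∈ D, inner ℝ v z ≤ 1) (hvy : inner ℝ v y = 1) (hvx : inner ℝ v x ≤ 0) : False := by
  -- By smoothness at `e₁`, a supporting form there has the same level line as `p₁`.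
  have key : ∀ w : EuclideanSpace ℝ (Fin 2), (∀ z ∈ D, inner ℝ w z ≤ 1) → inner ℝ w e₁ = 1 →
      inner ℝ w e₂ = 0 := by
    intro w hw hw1
    have := hsm.inner_eq_one (y := e₁ + e₂) h.mem₁ h.le₁ hw h.dual₁₁ hw1
      (by rw [inner_add_right, h.dual₁₁, h.dual₁₂, add_zero])
    rw [inner_add_right] at this
    linarith
  have ex : ∀ w z : EuclideanSpace ℝ (Fin 2),
      inner ℝ w z = inner ℝ p₁ z * inner ℝ w e₁ + inner ℝ p₂ z * inner ℝ w e₂ := by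
    intro w z
    conv_lhs => rw [h.expand z]
    rw [inner_add_right, real_inner_smul_right, real_inner_smul_right]
  have hku := key u hu
  have hkv := key v hv
  have hx₁' := h.le₁ x hx
  have hx₂' := h.le₂ x hx
  have hy₁' := h.le₁ y hy
  have hu1 := hu _ h.mem₁
  have hu2 := hu _ h.mem₂
  have hv1 := hv _ h.mem₁
  rw [ex] at hux huy hvy hvx
  generalize (inner ℝ p₁ x : ℝ) = x₁ at *
  generalize (inner ℝ p₂ x : ℝ) = x₂ at *
  generalize (inner ℝ p₁ y : ℝ) = y₁ at *
  generalize (inner ℝ p₂ y : ℝ) = y₂ at *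
  generalize (inner ℝ u e₁ : ℝ) = p at *
  generalize (inner ℝ u e₂ : ℝ) = q at *
  generalize (inner ℝ v e₁ : ℝ) = p' at *
  generalize (inner ℝ v e₂ : ℝ) = q' at *
  -- In coordinates `u = (p, q)`: both entries are nonnegative, so `u y ≤ 0` with `y₁ > 0` forces `p
  -- = 0`, then `q = 1` and `y₂ = 0`. Thus `v` supports at `e₁`, and `v x = x₁ > 0`, a
  -- contradiction.
  have hq : 0 ≤ q := by
    by_contra! hq
    have hp : p = 1 := by nlinarith
    exact hq.ne (hku hp)
  have hp : 0 ≤ p := by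
    by_contra! hp
    nlinarith
  have hp0 : p = 0 := by
    by_contra hne
    have : 0 < p := lt_of_le_of_ne hp (Ne.symm hne)
    nlinarith [mul_pos hy₁ this, mul_nonneg hy₂ hq]
  subst hp0
  have hq1 : q = 1 := by nlinarith
  subst hq1
  have hy0 : y₂ = 0 := by linarith
  subst hy0
  have hp1 : p' = 1 := by nlinarith
  rw [hkv hp1, hp1] at hvx
  linarith

/-- Two neighbours of a translate in the same half-open quadrant coincide. -/
theorem IsAuerbach.eq_of_adj {n : ℕ} (hD : IsConvexBody D) (hs : IsOSymmetric D)
    (hsm : IsSmooth D) {e₁ e₂ p₁ p₂ : EuclideanSpace ℝ (Fin 2)} (h : IsAuerbach D e₁ e₂ p₁ p₂)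
    {c : Fin n → EuclideanSpace ℝ (Fin 2)} (hc : IsTotallySeparablePacking D c) {i j k : Fin n}
    (hij : (contactGraph D c).Adj i j) (hik : (contactGraph D c).Adj i k)
    (hj : 0 < inner ℝ p₁ (c j - c i) ∧ 0 ≤ inner ℝ p₂ (c j - c i))
    (hk : 0 < inner ℝ p₁ (c k - c i) ∧ 0 ≤ inner ℝ p₂ (c k - c i)) : j = k := by
  by_contra hjk
  obtain ⟨x, hx, hjx⟩ := contactGraph_adj_exists hD hs hij
  obtain ⟨y, hy, hky⟩ := contactGraph_adj_exists hD hs hik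
  obtain ⟨u, hu, hux, huy⟩ := exists_form_of_adj hD hs hsm hc hij.1 hjk hx hy hjx hky
  obtain ⟨v, hv, hvy, hvx⟩ :=
    exists_form_of_adj hD hs hsm hc hik.1 (Ne.symm hjk) hy hx hky hjx
  rw [hjx, add_sub_cancel_left, real_inner_smul_right, real_inner_smul_right] at hj
  rw [hky, add_sub_cancel_left, real_inner_smul_right, real_inner_smul_right] at hk
  exact h.false_of_mem_quadrant hsm hx hy (by linarith [hj.1]) (by linarith [hj.2])
    (by linarith [hk.1]) (by linarith [hk.2]) hu hux huy hv hvy hvx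

/-- The cones `A` and `B` are the first two quadrants. Uniqueness of predecessors is uniqueness of
neighbours in the two opposite quadrants. -/
theorem contactNumber_le {n : ℕ} (hD : IsConvexBody D) (hs : IsOSymmetric D) (hsm : IsSmooth D)
    {c : Fin n → EuclideanSpace ℝ (Fin 2)} (hc : IsTotallySeparablePacking D c) :
    (contactNumber D c : ℝ) ≤ 2 * n - 2 * Real.sqrt n := by
  obtain ⟨e₁, e₂, p₁, p₂, h⟩ := exists_isAuerbach hD hs
  have h2 := h.rotate hs
  have h3 := h2.rotate hs
  have h4 := h3.rotate hs
  have flip : ∀ p x y : EuclideanSpace ℝ (Fin 2),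
      (inner ℝ p (x - y) : ℝ) = inner ℝ (-p) (y - x) := fun p x y => by
    rw [inner_neg_left, ← inner_neg_right, neg_sub]
  have := ncard_edgeSet_le_of_two_chain_relations (contactGraph D c) c
    (fun z => 0 < inner ℝ p₁ z ∧ 0 ≤ inner ℝ p₂ z)
    (fun z => 0 < inner ℝ p₂ z ∧ 0 ≤ inner ℝ (-p₁) z)
    (by simp) (by simp)
    (fun x y hx hy => by
      simp only [inner_add_right]; exact ⟨add_pos hx.1 hy.1, add_nonneg hx.2 hy.2⟩)
    (fun x y hx hy => by
      simp only [inner_add_right]; exact ⟨add_pos hx.1 hy.1, add_nonneg hx.2 hy.2⟩)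
    (fun x hx hx' => by rw [inner_neg_left] at hx'; linarith [hx.1, hx'.2])
    (fun x hx hx' => by rw [inner_neg_right] at hx'; linarith [hx.2, hx'.1])
    (fun i j hij => by
      have hne : ¬ (inner ℝ p₁ (c j - c i) = 0 ∧ inner ℝ p₂ (c j - c i) = 0) := by
        rintro ⟨h1', h2'⟩
        have hz := h.expand (c j - c i)
        rw [h1', h2', zero_smul, zero_smul, add_zero, sub_eq_zero] at hz
        obtain ⟨u, b, -, hi, hj, -⟩ := hc.exists_unit_form hD hs hij.1
        rw [hz] at hj
        linarith
      rw [← neg_sub (c j) (c i)]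
      simp only [inner_neg_right, inner_neg_left, neg_neg]
      rcases lt_trichotomy (inner ℝ p₁ (c j - c i)) 0 with h1' | h1' | h1' <;>
      rcases lt_trichotomy (inner ℝ p₂ (c j - c i)) 0 with h2' | h2' | h2' <;>
      first
        | exact Or.inl ⟨by linarith, by linarith⟩
        | exact Or.inr (Or.inl ⟨by linarith, by linarith⟩)
        | exact Or.inr (Or.inr (Or.inl ⟨by linarith, by linarith⟩))
        | exact Or.inr (Or.inr (Or.inr ⟨by linarith, by linarith⟩))
        | exact (hne ⟨h1', h2'⟩).elim)
    (fun i j k hij hik hj hk => h.eq_of_adj hD hs hsm hc hij hik hj hk)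
    (fun i j k hij hik hj hk => h2.eq_of_adj hD hs hsm hc hij hik hj hk)
    (fun i j k hij hik hj hk => h3.eq_of_adj hD hs hsm hc hij hik
      (by rwa [← flip, ← flip]) (by rwa [← flip, ← flip]))
    (fun i j k hij hik hj hk => h4.eq_of_adj hD hs hsm hc hij hik
      (by rwa [← flip, ← flip]) (by rwa [← flip, ← flip]))
  simpa [contactNumber] using this

/-! ### Lattice packings and the lower bound -/

/-- Translates centred at points of the lattice generated by twice an Auerbach basis form a totally
separable packing. -/
theorem IsAuerbach.isTotallySeparablePacking {n : ℕ} (hs : IsOSymmetric D)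
    {e₁ e₂ p₁ p₂ : EuclideanSpace ℝ (Fin 2)} (h : IsAuerbach D e₁ e₂ p₁ p₂)
    (a b : Fin n → ℤ) (hab : ∀ i j, a i = a j → b i = b j → i = j) :
    IsTotallySeparablePacking D
      (fun i => (2 * a i : ℝ) • e₁ + (2 * b i : ℝ) • e₂) := by
  set c : Fin n → EuclideanSpace ℝ (Fin 2) := fun i => (2 * a i : ℝ) • e₁ + (2 * b i : ℝ) • e₂
    with hcdef
  have hc1 : ∀ i, inner ℝ p₁ (c i) = 2 * a i := fun i => by
    simp [hcdef, inner_add_right, real_inner_smul_right, h.dual₁₁, h.dual₁₂]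
  have hc2 : ∀ i, inner ℝ p₂ (c i) = 2 * b i := fun i => by
    simp [hcdef, inner_add_right, real_inner_smul_right, h.dual₂₁, h.dual₂₂]
  have sep : ∀ (p : EuclideanSpace ℝ (Fin 2)) (m : Fin n → ℤ), p ≠ 0 → (∀ x ∈ D, inner ℝ p x ≤ 1) →
      (∀ i, inner ℝ p (c i) = 2 * m i) → ∀ i j, m i < m j →
      ∃ s : ℝ, (∀ x ∈ c i +ᵥ D, inner ℝ p x ≤ s) ∧ (∀ x ∈ c j +ᵥ D, s ≤ inner ℝ p x) ∧
        ∀ k, Disjoint {x | inner ℝ p x = s} (interior (c k +ᵥ D)) := by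
    intro p m hp hle hm i j hij
    have hge : ∀ x ∈ D, -1 ≤ inner ℝ p x := fun x hx => by
      have := hle _ (hs.neg_mem hx)
      rw [inner_neg_right] at this
      linarith
    have hij' : (m i : ℝ) + 1 ≤ m j := by exact_mod_cast hij
    -- On the interior of translate `k` the form lies strictly between `2 * m k - 1` and `2 * m k +
    -- 1`, so it misses every odd integer.
    refine ⟨2 * m i + 1, ?_, ?_, fun k => ?_⟩
    · intro x hx
      obtain ⟨z, hz, rfl⟩ := Set.mem_vadd_set.1 hx
      rw [vadd_eq_add, inner_add_right, hm]
      linarith [hle z hz]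
    · intro x hx
      obtain ⟨z, hz, rfl⟩ := Set.mem_vadd_set.1 hx
      rw [vadd_eq_add, inner_add_right, hm]
      linarith [hge z hz]
    · rw [Set.disjoint_left]
      intro x hx hx'
      rw [interior_vadd] at hx'
      obtain ⟨z, hz, rfl⟩ := Set.mem_vadd_set.1 hx'
      rw [Set.mem_ofPred_eq, vadd_eq_add, inner_add_right, hm] at hx
      have h1 := inner_lt_of_mem_interior hp hle hz
      have h2 := inner_lt_of_mem_interior (u := -p) (s := 1) (neg_ne_zero.2 hp)
        (fun x hx => by rw [inner_neg_left]; linarith [hge x hx]) hz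
      rw [inner_neg_left] at h2
      have h3 : (m k : ℝ) < m i + 1 := by linarith
      have h4 : (m i : ℝ) < m k := by linarith
      have h3' : m k < m i + 1 := by exact_mod_cast h3
      have h4' : m i < m k := by exact_mod_cast h4
      omega
  have hp₁ : p₁ ≠ 0 := by rintro rfl; simpa using h.dual₁₁
  have hp₂ : p₂ ≠ 0 := by rintro rfl; simpa using h.dual₂₂
  have main : ∀ i j, i ≠ j → ∃ (u : EuclideanSpace ℝ (Fin 2)) (s : ℝ), u ≠ 0 ∧
      (∀ x ∈ c i +ᵥ D, inner ℝ u x ≤ s) ∧ (∀ x ∈ c j +ᵥ D, s ≤ inner ℝ u x) ∧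
      ∀ k, Disjoint {x | inner ℝ u x = s} (interior (c k +ᵥ D)) := by
    intro i j hij
    have h2 := h.rotate hs
    have h3 := h2.rotate hs
    rcases lt_trichotomy (a i) (a j) with hlt | heq | hgt
    · obtain ⟨s, hs'⟩ := sep p₁ a hp₁ h.le₁ hc1 i j hlt
      exact ⟨p₁, s, hp₁, hs'⟩
    · rcases lt_trichotomy (b i) (b j) with hlt | heq' | hgt
      · obtain ⟨s, hs'⟩ := sep p₂ b hp₂ h.le₂ hc2 i j hlt
        exact ⟨p₂, s, hp₂, hs'⟩
      · exact (hij (hab i j heq heq')).elim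
      · obtain ⟨s, hs'⟩ := sep (-p₂) (fun k => -b k) (neg_ne_zero.2 hp₂) h3.le₂
          (fun k => by rw [inner_neg_left, hc2]; push_cast; ring) i j (by simpa using hgt)
        exact ⟨-p₂, s, neg_ne_zero.2 hp₂, hs'⟩
    · obtain ⟨s, hs'⟩ := sep (-p₁) (fun k => -a k) (neg_ne_zero.2 hp₁) h2.le₂
        (fun k => by rw [inner_neg_left, hc1]; push_cast; ring) i j (by simpa using hgt)
      exact ⟨-p₁, s, neg_ne_zero.2 hp₁, hs'⟩
  refine ⟨fun i j hij => ?_, main⟩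
  obtain ⟨u, s, hu, hi, hj, hk⟩ := main i j hij
  rw [Set.disjoint_left]
  intro x hx hx'
  exact Set.disjoint_left.1 (hk i)
    (le_antisymm (hi x (interior_subset hx)) (hj x (interior_subset hx'))) hx

/-- A totally separable packing along the square lattice, filled row by row in rows of length
`w`, has at least `2n - w - ⌈n / w⌉` contacts. -/
theorem exists_packing_contactNumber_ge (hD : IsConvexBody D) (hs : IsOSymmetric D) {n w : ℕ}
    (hw : 2 ≤ w) : ∃ c : Fin n → EuclideanSpace ℝ (Fin 2),
      IsTotallySeparablePacking D c ∧ (n - w) + ((n - 1) - (n - 1) / w) ≤ contactNumber D c := by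
  classical
  obtain ⟨e₁, e₂, p₁, p₂, h⟩ := exists_isAuerbach hD hs
  have hw0 : 0 < w := by omega
  let a : Fin n → ℤ := fun k => ((k.1 / w : ℕ) : ℤ)
  let b : Fin n → ℤ := fun k => ((k.1 % w : ℕ) : ℤ)
  have hab : ∀ i j, a i = a j → b i = b j → i = j := by
    intro i j h1 h2
    have h1' : i.1 / w = j.1 / w := Int.natCast_inj.1 h1
    have h2' : i.1 % w = j.1 % w := Int.natCast_inj.1 h2
    apply Fin.ext
    rw [← Nat.div_add_mod i.1 w, ← Nat.div_add_mod j.1 w, h1', h2']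
  refine ⟨_, h.isTotallySeparablePacking hs a b hab, ?_⟩
  set c : Fin n → EuclideanSpace ℝ (Fin 2) := fun i => (2 * a i : ℝ) • e₁ + (2 * b i : ℝ) • e₂
    with hcdef
  have touch : ∀ (e : EuclideanSpace ℝ (Fin 2)), e ∈ D → ∀ i j : Fin n, i ≠ j →
      c j = c i + (2 : ℝ) • e → (contactGraph D c).Adj i j := by
    intro e he i j hij hji
    refine ⟨hij, c i + e, Set.mem_vadd_set.2 ⟨e, he, rfl⟩,
      Set.mem_vadd_set.2 ⟨-e, hs.neg_mem he, ?_⟩⟩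
    rw [vadd_eq_add, hji, two_smul]
    abel
  -- `S` indexes contacts `k, k + w` between consecutive rows, and `T` contacts `k, k + 1` within a
  -- row, where `w ∣ k + 1` marks a row break. Since `w ≥ 2`, the two kinds are distinct.
  let S : Finset ℕ := Finset.range (n - w)
  let T : Finset ℕ := {k ∈ Finset.range (n - 1) | ¬ w ∣ k + 1}
  have hT : T.card = (n - 1) - (n - 1) / w := by
    have h1 := Finset.card_filter_add_card_filter_not (s := Finset.range (n - 1))
      (fun k => w ∣ k + 1)
    rw [Nat.card_multiples, Finset.card_range] at h1
    exact Nat.eq_sub_of_add_eq' h1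
  have hS : S.card = n - w := Finset.card_range _
  rcases Nat.eq_zero_or_pos n with rfl | hn
  · simp
  -- Reduction mod `n` only makes `ι` total; all indices used are below `n`.
  let ι : ℕ → Fin n := fun k => ⟨k % n, Nat.mod_lt _ hn⟩
  have hι : ∀ k, k < n → (ι k).1 = k := fun k hk => Nat.mod_eq_of_lt hk
  let U : Finset (Sym2 (Fin n)) :=
    S.image (fun k => s(ι k, ι (k + w))) ∪ T.image (fun k => s(ι k, ι (k + 1)))
  have hU : (U : Set (Sym2 (Fin n))) ⊆ (contactGraph D c).edgeSet := by
    intro e he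
    simp only [U, Finset.coe_union, Finset.coe_image, Set.mem_union, Set.mem_image,
      Finset.mem_coe, S, T, Finset.mem_filter, Finset.mem_range] at he
    rcases he with ⟨k, hk, rfl⟩ | ⟨k, ⟨hk, hd⟩, rfl⟩
    · have h1 := hι k (by omega)
      have h2 := hι (k + w) (by omega)
      refine touch e₁ h.mem₁ _ _ (fun heq => ?_) ?_
      · exact absurd ((h1.symm.trans (congrArg Fin.val heq)).trans h2) (by omega)
      · have ha : a (ι (k + w)) = a (ι k) + 1 := by
          simp only [a, h1, h2, Nat.add_div_right k hw0]; push_cast; ring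
        have hb : b (ι (k + w)) = b (ι k) := by simp only [b, h1, h2, Nat.add_mod_right]
        simp only [hcdef, ha, hb]
        push_cast
        module
    · have h1 := hι k (by omega)
      have h2 := hι (k + 1) (by omega)
      refine touch e₂ h.mem₂ _ _ (fun heq => ?_) ?_
      · exact absurd ((h1.symm.trans (congrArg Fin.val heq)).trans h2) (by omega)
      · have ha : a (ι (k + 1)) = a (ι k) := by
          simp only [a, h1, h2, Nat.succ_div_of_not_dvd hd]
        have hb : b (ι (k + 1)) = b (ι k) + 1 := by
          have e1 := Nat.div_add_mod k w
          have e2 := Nat.div_add_mod (k + 1) w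
          rw [Nat.succ_div_of_not_dvd hd] at e2
          simp only [b, h1, h2]
          omega
        simp only [hcdef, ha, hb]
        push_cast
        module
  have hpair : ∀ i j k l : ℕ, i < j → j < n → k < l → l < n → s(ι i, ι j) = s(ι k, ι l) →
      i = k ∧ j = l := by
    intro i j k l hij hj hkl hl heq
    rw [Sym2.eq_iff] at heq
    have e1 := hι i (by omega)
    have e2 := hι j (by omega)
    have e3 := hι k (by omega)
    have e4 := hι l (by omega)
    rcases heq with ⟨h1, h2⟩ | ⟨h1, h2⟩
    · rw [h1] at e1; rw [h2] at e2; omega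
    · rw [h1] at e1; rw [h2] at e2; omega
  have hUcard : U.card = S.card + T.card := by
    rw [Finset.card_union_of_disjoint, Finset.card_image_of_injOn, Finset.card_image_of_injOn]
    · intro k hk l hl heq
      simp only [T, Finset.coe_filter, Finset.mem_range, Set.mem_ofPred_eq] at hk hl
      exact (hpair _ _ _ _ (by omega) (by omega) (by omega) (by omega) heq).1
    · intro k hk l hl heq
      simp only [S, Finset.coe_range, Set.mem_Iio] at hk hl
      exact (hpair _ _ _ _ (by omega) (by omega) (by omega) (by omega) heq).1
    · rw [Finset.disjoint_left]
      intro e he he'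
      simp only [Finset.mem_image, S, T, Finset.mem_filter, Finset.mem_range] at he he'
      obtain ⟨k, hk, rfl⟩ := he
      obtain ⟨l, ⟨hl, -⟩, heq⟩ := he'
      have := hpair _ _ _ _ (by omega) (by omega) (by omega) (by omega) heq
      omega
  calc (n - w) + ((n - 1) - (n - 1) / w) = U.card := by rw [hUcard, hS, hT]
    _ = (U : Set (Sym2 (Fin n))).ncard := (Set.ncard_coe_finset U).symm
    _ ≤ contactNumber D c := Set.ncard_le_ncard hU (Set.toFinite _)

/-- Rows of length `w = ⌈√n⌉` fill the square lattice optimally. -/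
theorem exists_row_length {n : ℕ} (hn : 2 ≤ n) : ∃ w : ℕ, 2 ≤ w ∧
    2 * (n : ℝ) - 2 * Real.sqrt n < ((n - w) + ((n - 1) - (n - 1) / w) : ℕ) + 1 := by
  -- Taking the root of `n - 1` gives `v < √n ≤ v + 1`, so `v + 1 = ⌈√n⌉` even when `n` is a square.
  obtain ⟨v, hv⟩ : ∃ v, v = Nat.sqrt (n - 1) := ⟨_, rfl⟩
  have h1 : v * v ≤ n - 1 := hv ▸ Nat.sqrt_le (n - 1)
  have h2 : n - 1 < (v + 1) * (v + 1) := hv ▸ Nat.lt_succ_sqrt (n - 1)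
  have hv1 : 1 ≤ v := by
    by_contra! h
    have : v = 0 := by omega
    subst this
    omega
  have hn1 : 1 ≤ n := by omega
  refine ⟨v + 1, by omega, ?_⟩
  have hle : v + 1 ≤ n := by nlinarith [Nat.sub_add_cancel hn1]
  obtain ⟨q, hq⟩ : ∃ q, q = (n - 1) / (v + 1) := ⟨_, rfl⟩
  have hqv : q ≤ v := by
    rw [hq]; exact Nat.lt_succ_iff.1 ((Nat.div_lt_iff_lt_mul (by omega)).2 h2)
  have hqn : q * (v + 1) ≤ n - 1 := hq ▸ Nat.div_mul_le_self _ _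
  rw [← hq]
  have hqle : q ≤ n - 1 := hq ▸ Nat.div_le_self _ _
  rw [Nat.cast_add, Nat.cast_sub hle, Nat.cast_sub hqle, Nat.cast_sub hn1]
  push_cast
  -- If `q < v`, the left side is at most `v < √n`. If `q = v`, its square is `v² + v + 1/4`, less
  -- than `v (v + 1) + 1 ≤ n`.
  have key : ((v : ℝ) + q + 1) / 2 < Real.sqrt n := by
    apply Real.lt_sqrt_of_sq_lt
    have hqn' : (q : ℝ) * (v + 1) + 1 ≤ n := by exact_mod_cast (by omega : q * (v + 1) + 1 ≤ n)
    have h1' : (v : ℝ) * v + 1 ≤ n := by exact_mod_cast (by omega : v * v + 1 ≤ n)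
    rcases Nat.lt_or_ge q v with hlt | hge
    · have : (q : ℝ) + 1 ≤ v := by exact_mod_cast hlt
      have hq0 : (0 : ℝ) ≤ q := by positivity
      nlinarith
    · have : (q : ℝ) = v := by exact_mod_cast le_antisymm hqv hge
      rw [this] at hqn' ⊢
      nlinarith
  linarith

/-- The maximum separable contact number of a smooth `o`-symmetric convex domain. -/
theorem isGreatest_sepContactNumbers (hD : IsConvexBody D) (hs : IsOSymmetric D)
    (hsm : IsSmooth D) {n : ℕ} (hn : 2 ≤ n) :
    IsGreatest (sepContactNumbers D n) ⌊2 * (n : ℝ) - 2 * Real.sqrt n⌋₊ := by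
  have hub : ∀ c : Fin n → EuclideanSpace ℝ (Fin 2), IsTotallySeparablePacking D c →
      contactNumber D c ≤ ⌊2 * (n : ℝ) - 2 * Real.sqrt n⌋₊ :=
    fun c hc => Nat.le_floor (contactNumber_le hD hs hsm hc)
  refine ⟨?_, ?_⟩
  · obtain ⟨w, hw, hlt⟩ := exists_row_length hn
    obtain ⟨c, hc, hge⟩ := exists_packing_contactNumber_ge hD hs (n := n) hw
    refine ⟨c, hc, le_antisymm (hub c hc) (le_trans ?_ hge)⟩
    exact Nat.lt_succ_iff.1 ((Nat.floor_lt' (by omega)).2 (by push_cast at hlt ⊢; exact hlt))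
  · rintro m ⟨c, hc, rfl⟩
    exact hub c hc

/-! ### The Euclidean disk and the conclusion -/

theorem isConvexBody_closedBall :
    IsConvexBody (Metric.closedBall (0 : EuclideanSpace ℝ (Fin 2)) 1) where
  isCompact := isCompact_closedBall _ _
  convex := convex_closedBall _ _
  interior_nonempty := by
    rw [interior_closedBall _ one_ne_zero]
    exact Metric.nonempty_ball.2 one_pos

theorem isOSymmetric_closedBall :
    IsOSymmetric (Metric.closedBall (0 : EuclideanSpace ℝ (Fin 2)) 1) := by
  ext x; simp

/-- Equality in the Cauchy–Schwarz inequality makes every outer normal at `p` a positive multiple of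
`p`. -/
theorem isSmooth_closedBall :
    IsSmooth (Metric.closedBall (0 : EuclideanSpace ℝ (Fin 2)) 1) := by
  intro p hp
  rw [frontier_closedBall _ one_ne_zero, mem_sphere_zero_iff_norm] at hp
  have hp0 : p ≠ 0 := by rintro rfl; simp at hp
  refine ⟨{x | inner ℝ p x = inner ℝ p p}, ⟨p, hp0, rfl, fun x hx => ?_⟩, ?_⟩
  · rw [mem_closedBall_zero_iff] at hx
    calc inner ℝ p x ≤ ‖p‖ * ‖x‖ := real_inner_le_norm _ _
      _ ≤ 1 := by rw [hp, one_mul]; exact hx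
      _ = inner ℝ p p := by rw [real_inner_self_eq_norm_sq, hp]; norm_num
  · rintro H ⟨u, hu, rfl, hmax⟩
    have hu' : ‖u‖ ≠ 0 := norm_ne_zero_iff.2 hu
    have h1 := hmax (‖u‖⁻¹ • u) (by
      rw [mem_closedBall_zero_iff, norm_smul, norm_inv, norm_norm, inv_mul_cancel₀ hu'])
    rw [real_inner_smul_right, real_inner_self_eq_norm_sq, sq, inv_mul_cancel_left₀ hu'] at h1
    have h2 : inner ℝ u p = ‖u‖ * ‖p‖ :=
      le_antisymm (real_inner_le_norm _ _) (by rw [hp, mul_one]; exact h1)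
    have h3 := inner_eq_norm_mul_iff_real.1 h2
    rw [hp, one_smul] at h3
    ext x
    rw [h3]
    simp only [Set.mem_ofPred_eq, real_inner_smul_left]
    exact mul_right_inj' hu'

end SepPacking

theorem mainTheorem3 (D : Set (EuclideanSpace ℝ (Fin 2))) (hD : SepPacking.IsBDomain D)
    (hsmooth : SepPacking.IsSmooth D) (n : ℕ) (hn : 2 ≤ n) :
    IsGreatest (SepPacking.sepContactNumbers D n) (SepPacking.cSep D n) ∧
      SepPacking.cSep D n =
        SepPacking.cSep (Metric.closedBall (0 : EuclideanSpace ℝ (Fin 2)) 1) n ∧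
      (SepPacking.cSep D n : ℤ) = ⌊2 * (n : ℝ) - 2 * Real.sqrt n⌋ := by
  have hgr := SepPacking.isGreatest_sepContactNumbers hD.isConvexBody hD.isOSymmetric hsmooth hn
  have hball := SepPacking.isGreatest_sepContactNumbers SepPacking.isConvexBody_closedBall
    SepPacking.isOSymmetric_closedBall SepPacking.isSmooth_closedBall hn
  have h1 : SepPacking.cSep D n = ⌊2 * (n : ℝ) - 2 * Real.sqrt n⌋₊ := hgr.csSup_eq
  have h2 : SepPacking.cSep (Metric.closedBall (0 : EuclideanSpace ℝ (Fin 2)) 1) n =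
      ⌊2 * (n : ℝ) - 2 * Real.sqrt n⌋₊ := hball.csSup_eq
  refine ⟨by rw [h1]; exact hgr, by rw [h1, h2], ?_⟩
  rw [h1]
  -- The natural and integer floors agree because `√n ≤ n` makes `2n - 2√n` nonnegative.
  refine Int.natCast_floor_eq_floor ?_
  have hn' : (1 : ℝ) ≤ n := by exact_mod_cast (by omega : 1 ≤ n)
  have : Real.sqrt n ≤ n := Real.sqrt_le_iff.2 ⟨by linarith, by nlinarith⟩
  linarith
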